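/- Let $(X,\mathrm{dist})$ be a finite metric space, $P\subseteq X$ a set of clients, $k,z\ge 1$ integers and $\varepsilon>0$. For a nonempty set $S\subseteq X$ and $p\in X$ put $\mathrm{cost}(p,S)=\min_{s\in S}\mathrm{dist}(p,s)^z$. A subset $\Omega\subseteq P$ with weights $w:\Omega\to[0,\infty)$ is an $(\varepsilon,k,z)$-coreset of $P$ using offset $\Delta\in\mathbb R$ if for every set $S\subseteq X$ with $|S|=k$, \[\Bigl|\sum_{p\in P}\mathrm{cost}(p,S)-\Bigl(\Delta+\sum_{p\in\Omega}w(p)\,\mathrm{cost}(p,S)\Bigr)\Bigr|\le\varepsilon\sum_{p\in P}\mathrm{cost}(p,S).\] Theorem. For every $\alpha>0$ there is a constant $c>0$, depending only on $\alpha$, such that the following holds for all $0<\varepsilon<1/2$ and all integers $k\ge1$, $z\ge1$ and $n\ge\varepsilon^{-5}$ with $k\,\varepsilon^{-2}\le n^{1-\alpha}$. There are a metric space $X$ with exactly $n$ points and a set of clients $P\subseteq X$ such that for every offset $\Delta\in\mathbb R$, every $(\varepsilon,k,z)$-coreset of $P$ using offset $\Delta$ consists of at least $c\cdot k\,\varepsilon^{-2}\log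 n$ points. (The condition $k\varepsilon^{-2}\le n^{1-\alpha}$ makes precise the requirement that $k$ be at most polynomial in the number of points per cluster. It is satisfied, with a suitable $\alpha>0$ depending only on $A$, whenever $n\ge k\varepsilon^{-5}$ and $\log k\le A\log(n/k)$; and, with $\alpha=3/5-\theta$, whenever $n\ge\varepsilon^{-5}$ and $\log k\le\theta\log n$ for a constant $\theta<3/5$.) -/

import Mathlib

namespace Clustering

noncomputable section

/-- The cost of serving the point `p` by the (nonempty, finite) set of centers `S`:
the minimum over `s ∈ S` of `dist p s ^ z`. -/
def cost {X : Type*} [MetricSpace X] (z : ℕ) (p : X) (S : Finset X) : ℝ :=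
  ⨅ s : S, dist p (s : X) ^ z

/-- `IsCoreset ε k z P Ω w Δ`: the subset `Ω` of the client set `P`, with nonnegative weights `w`,
is an `(ε, k, z)`-coreset of `P` using offset `Δ`. Only the values of `w` on `Ω` matter, and the
centers range over all sets of exactly `k` points of the ambient space. -/
structure IsCoreset {X : Type*} [MetricSpace X] (ε : ℝ) (k z : ℕ) (P Ω : Finset X)
    (w : X → ℝ) (Δ : ℝ) : Prop where
  subset : Ω ⊆ P
  weight_nonneg : ∀ p ∈ Ω, 0 ≤ w p
  approx : ∀ S : Finset X, S.card = k →
    |∑ p ∈ P, cost z p S - (Δ + ∑ p ∈ Ω, w p * cost z p S)| ≤ ε * ∑ p ∈ P, cost z p S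

end

end Clustering

/-!
The hard instance consists of `k` clusters at mutual distance `3`. Each cluster has `L * B` clients, arranged
in `L` blocks of size `B`, with `L` of order `log n` and `B` of order `ε⁻²`, together with
candidate centers that see every client at distance `1` or `3 ^ (1 / z)`, so that all costs are
`2 + σ` with a sign `σ` (`pointDist`). The sign patterns are those of a family of `J` patterns, in
which moreover the sign of each block may be chosen freely (`blockPattern`). The remaining points
form a far away set. A coreset becomes a weight vector on the clients that predicts the total cost
for each choice of one center per cluster and for far centers
(`exists_space_of_sign_pattern`, `IsSketch`).

For small `ε`, let `u` be the difference between the weights `1` of the clients and the weights of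
the coreset; it is `1` outside the coreset. The inner product of `u` with a random sign pattern on
a block has typical size at least its `L²` norm, by Khinchine's inequality (`le_sum_abs_rad`), and
the sum over the blocks exceeds a constant multiple of its mean with constant probability
(`card_le_card_filter_rad`). A greedy covering argument over the finitely many vectors with
bounded integer entries therefore yields a family of about `B (log n) ^ 2` patterns, one of which
works for each rounded `u` (`exists_hitting_family`); the far centers bound the weights, so that
rounding is harmless. Flipping the signs of the blocks changes the error by order `√B` per block
if half of the clients are missing from the coreset, whereas an `ε`-coreset allows order `ε B`
only, which is smaller when `B` is a small multiple of `ε⁻²` (`IsSketch.card_le_two_mul`). A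
comparison of two choices of centers also removes the offset.

The free choice of the block signs costs a factor `2 ^ L` in the number of centers, a small power
of `n`, and this is where `k ε⁻² ≤ n ^ (1 - α)` enters (`exists_parameters`). For `ε` bounded below,
blocks of size one suffice (`IsSketch.card_le_five_mul`), and for bounded `n` the claim is only
that a coreset of a suitable client set is nonempty (`IsCoreset.nonempty_of_singleton`).
-/

namespace Clustering

open Finset Filter

/-! ### Rademacher sums over the Boolean cube -/

/-- The sign of a Boolean: `1` for `true`, `-1` for `false`. -/
def sgn (b : Bool) : ℝ := if b then 1 else -1

lemma sgn_not (b : Bool) : sgn (!b) = -sgn b := by cases b <;> simp [sgn]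

lemma sgn_mul_self (b : Bool) : sgn b * sgn b = 1 := by cases b <;> simp [sgn]

lemma sgn_beq (a b : Bool) : sgn (a == b) = sgn a * sgn b := by
  cases a <;> cases b <;> simp [sgn]

lemma abs_sgn (b : Bool) : |sgn b| = 1 := by cases b <;> simp [sgn]

lemma exists_sgn_mul_eq_abs (x : ℝ) : ∃ b, sgn b * x = |x| := by
  rcases le_total 0 x with h | h
  · exact ⟨true, by simp [sgn, abs_of_nonneg h]⟩
  · exact ⟨false, by simp [sgn, abs_of_nonpos h]⟩

section Rademacher

variable {D : Type*} [DecidableEq D]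

/-- The involution of the Boolean cube that flips the coordinate `e`. -/
def flipAt (e : D) : Equiv.Perm (D → Bool) :=
  Function.Involutive.toPerm (fun h => Function.update h e (!h e)) fun h => by
    ext d; by_cases hd : d = e
    · subst hd; simp
    · simp [hd]

lemma flipAt_same (e : D) (h : D → Bool) : flipAt e h e = !h e :=
  Function.update_self ..

lemma flipAt_of_ne {e d : D} (hd : d ≠ e) (h : D → Bool) : flipAt e h d = h d :=
  Function.update_of_ne hd ..

/-- The Rademacher sum with coefficients `a` over the coordinates in `s`. -/
def rad (a : D → ℝ) (s : Finset D) (h : D → Bool) : ℝ := ∑ d ∈ s, a d * sgn (h d)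

lemma rad_insert (a : D → ℝ) {s : Finset D} {e : D} (he : e ∉ s) (h : D → Bool) :
    rad a (insert e s) h = rad a s h + a e * sgn (h e) := by
  rw [rad, sum_insert he, add_comm]; rfl

lemma rad_flipAt (a : D → ℝ) {s : Finset D} {e : D} (he : e ∉ s) (h : D → Bool) :
    rad a s (flipAt e h) = rad a s h :=
  sum_congr rfl fun d hd => by rw [flipAt_of_ne (by rintro rfl; exact he hd)]

variable [Fintype D]

/-- A function that does not depend on the coordinate `e` is orthogonal to the sign of that
coordinate. -/
lemma sum_mul_sgn_eq_zero (e : D) (g : (D → Bool) → ℝ) (hg : ∀ h, g (flipAt e h) = g h) :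
    ∑ h, g h * sgn (h e) = 0 := by
  have h1 : ∑ h, g h * sgn (h e) = ∑ h, g (flipAt e h) * sgn (flipAt e h e) :=
    (Equiv.sum_comp (flipAt e) fun h => g h * sgn (h e)).symm
  simp only [hg, flipAt_same, sgn_not, mul_neg, sum_neg_distrib] at h1
  linarith

lemma sum_rad_sq (a : D → ℝ) (s : Finset D) :
    ∑ h, rad a s h ^ 2 = Fintype.card (D → Bool) * ∑ d ∈ s, a d ^ 2 := by
  induction s using Finset.induction_on with
  | empty => simp [rad]
  | insert e s he ih =>
    have key : ∀ h, rad a (insert e s) h ^ 2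
        = rad a s h ^ 2 + 2 * a e * (rad a s h * sgn (h e)) + a e ^ 2 := fun h => by
      rw [rad_insert a he]; linear_combination a e ^ 2 * sgn_mul_self (h e)
    have hz := sum_mul_sgn_eq_zero e (rad a s) (rad_flipAt a he)
    simp only [key, sum_add_distrib, ← mul_sum, hz, ih, sum_insert he, sum_const, card_univ,
      nsmul_eq_mul]
    ring

lemma sum_rad_pow_four_le (a : D → ℝ) (s : Finset D) :
    ∑ h, rad a s h ^ 4 ≤ 3 * (Fintype.card (D → Bool) * (∑ d ∈ s, a d ^ 2) ^ 2) := by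
  induction s using Finset.induction_on with
  | empty => simp [rad]
  | insert e s he ih =>
    have key : ∀ h, rad a (insert e s) h ^ 4
        = rad a s h ^ 4 + 6 * a e ^ 2 * rad a s h ^ 2 + a e ^ 4
          + 4 * a e * (rad a s h ^ 3 * sgn (h e)) + 4 * a e ^ 3 * (rad a s h * sgn (h e)) :=
      fun h => by
        rw [rad_insert a he]
        linear_combination (6 * a e ^ 2 * rad a s h ^ 2 + 4 * a e ^ 3 * rad a s h * sgn (h e)
          + a e ^ 4 * (sgn (h e) * sgn (h e) + 1)) * sgn_mul_self (h e)
    have hz := sum_mul_sgn_eq_zero e (rad a s) (rad_flipAt a he)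
    have hz3 := sum_mul_sgn_eq_zero e (fun h => rad a s h ^ 3)
      (fun h => by rw [rad_flipAt a he])
    simp only [key, sum_add_distrib, ← mul_sum, hz, hz3, sum_rad_sq, sum_insert he, sum_const,
      card_univ, nsmul_eq_mul]
    have : (0 : ℝ) ≤ Fintype.card (D → Bool) * a e ^ 4 := by positivity
    nlinarith

/-- Khinchine's inequality for the first moment: the mean of `|X|` is at least half of the
`L²` norm of `X`. -/
lemma le_sum_abs_rad (a : D → ℝ) (s : Finset D) :
    Fintype.card (D → Bool) * (√(∑ d ∈ s, a d ^ 2) / 2) ≤ ∑ h, |rad a s h| := by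
  set v := ∑ d ∈ s, a d ^ 2 with hv
  have hv0 : 0 ≤ v := sum_nonneg fun d _ => sq_nonneg _
  rcases hv0.eq_or_lt with h0 | h0
  · rw [← h0]; simp; positivity
  set r := √v with hr
  have hr0 : 0 < r := Real.sqrt_pos.2 h0
  have hrv : r ^ 2 = v := Real.sq_sqrt hv0
  -- With `y = |x| / (2 r)`, this is `y ≥ (3 y² - y⁴) / 2`, that is `(y - 1)² (y + 2) ≥ 0`.
  have key : ∀ x : ℝ, (12 * r ^ 2 * x ^ 2 - x ^ 4) / (16 * r ^ 3) ≤ |x| := fun x => by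
    rw [div_le_iff₀ (by positivity)]
    have hy := abs_nonneg x
    have h2 : x ^ 2 = |x| ^ 2 := (sq_abs x).symm
    have h4 : x ^ 4 = |x| ^ 4 := by rw [show x ^ 4 = (x ^ 2) ^ 2 by ring, h2]; ring
    rw [h2, h4]
    have : 0 ≤ |x| * ((|x| - 2 * r) ^ 2 * (|x| + 4 * r)) := by positivity
    nlinarith
  have h2 := sum_rad_sq a s
  have h4 := sum_rad_pow_four_le a s
  rw [← hv, ← hrv] at h2 h4
  calc (Fintype.card (D → Bool) : ℝ) * (r / 2)
      ≤ Fintype.card (D → Bool) * (9 / 16 * r) := by gcongr; linarith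
    _ = (12 * r ^ 2 * (Fintype.card (D → Bool) * r ^ 2)
          - 3 * (Fintype.card (D → Bool) * (r ^ 2) ^ 2)) / (16 * r ^ 3) := by
        field_simp; ring
    _ ≤ (12 * r ^ 2 * ∑ h, rad a s h ^ 2 - ∑ h, rad a s h ^ 4) / (16 * r ^ 3) := by
        rw [h2]; gcongr
    _ = ∑ h, (12 * r ^ 2 * rad a s h ^ 2 - rad a s h ^ 4) / (16 * r ^ 3) := by
        rw [← sum_div, sum_sub_distrib, mul_sum]
    _ ≤ _ := sum_le_sum fun h _ => key _

/-- A Paley–Zygmund inequality for a sum of absolute values of Rademacher sums over several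
blocks `s l` of coordinates: with probability at least `1/16`, the sum is at least a quarter of
the sum of the `L²` norms of the blocks. -/
lemma card_le_card_filter_rad {ι : Type*} [Fintype ι] (a : D → ℝ) (s : ι → Finset D) :
    (Fintype.card (D → Bool) : ℝ) / 16 ≤
      (univ.filter fun h : D → Bool =>
        (∑ l, √(∑ d ∈ s l, a d ^ 2)) / 4 ≤ ∑ l, |rad a (s l) h|).card := by
  set N : ℝ := ((Fintype.card (D → Bool) : ℕ) : ℝ) with hN
  have hN0 : 0 ≤ N := by positivity
  set r : ι → ℝ := fun l => √(∑ d ∈ s l, a d ^ 2) with hr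
  set R := ∑ l, r l with hR
  set Y : (D → Bool) → ℝ := fun h => ∑ l, |rad a (s l) h| with hY
  have hr0 : ∀ l, 0 ≤ r l := fun l => Real.sqrt_nonneg _
  have hrsq : ∀ l, r l ^ 2 = ∑ d ∈ s l, a d ^ 2 := fun l =>
    Real.sq_sqrt (sum_nonneg fun d _ => sq_nonneg _)
  have hY0 : ∀ h, 0 ≤ Y h := fun h => sum_nonneg fun l _ => abs_nonneg _
  have hR0 : 0 ≤ R := sum_nonneg fun l _ => hr0 l
  rcases hR0.eq_or_lt with h0 | h0
  · rw [← h0, filter_true_of_mem (fun h _ => by simpa using hY0 h), card_univ, ← hN]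
    linarith
  have h1 : N * (R / 2) ≤ ∑ h, Y h := by
    rw [hY, sum_comm, hR, sum_div, mul_sum]
    exact sum_le_sum fun l _ => le_sum_abs_rad a (s l)
  have h2 : ∑ h, Y h ^ 2 ≤ N * R ^ 2 := by
    -- Cauchy–Schwarz with weights `r l`; blocks with `r l = 0` contribute nothing to `Y`.
    have hzero : ∀ l, r l = 0 → ∀ h, rad a (s l) h = 0 := fun l hl h => by
      have hs : ∑ d ∈ s l, a d ^ 2 = 0 := by rw [← hrsq, hl]; simp
      refine sum_eq_zero fun d hd => ?_
      have := (sum_eq_zero_iff_of_nonneg fun d _ => sq_nonneg (a d)).1 hs d hd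
      rw [pow_eq_zero_iff two_ne_zero |>.1 this, zero_mul]
    have hcs : ∀ h, Y h ^ 2 ≤ R * ∑ l, rad a (s l) h ^ 2 / r l := fun h => by
      refine sum_sq_le_sum_mul_sum_of_sq_le_mul _ (fun l _ => hr0 l)
        (fun l _ => div_nonneg (sq_nonneg _) (hr0 l)) fun l _ => ?_
      by_cases hl : r l = 0
      · simp [hzero l hl h]
      · rw [sq_abs, mul_div_cancel₀ _ hl]
    calc ∑ h, Y h ^ 2 ≤ ∑ h, R * ∑ l, rad a (s l) h ^ 2 / r l := sum_le_sum fun h _ => hcs h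
      _ = R * ∑ l, (∑ h, rad a (s l) h ^ 2) / r l := by
          rw [← mul_sum, sum_comm]; simp only [sum_div]
      _ = R * ∑ l, N * r l := by
          congr 1
          refine sum_congr rfl fun l _ => ?_
          rw [sum_rad_sq, ← hrsq, ← hN]
          by_cases hl : r l = 0
          · simp [hl]
          · field_simp
      _ = N * R ^ 2 := by rw [← mul_sum, ← hR]; ring
  have key : ∀ h, Y h ≤ R / 4 + Y h ^ 2 / (8 * R) + if R / 4 ≤ Y h then 2 * R else 0 :=
    fun h => by
      have hp : 0 ≤ Y h ^ 2 / (8 * R) := by positivity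
      split_ifs with hc
      · have : Y h ≤ Y h ^ 2 / (8 * R) + 2 * R := by
          rw [← sub_nonneg]
          have : Y h ^ 2 / (8 * R) + 2 * R - Y h = (Y h - 4 * R) ^ 2 / (8 * R) := by
            field_simp; ring
          rw [this]; positivity
        linarith
      · push Not at hc; linarith
  have h3 : ∑ h, Y h ≤ N * (R / 4) + (N * R ^ 2) / (8 * R)
      + (univ.filter fun h => R / 4 ≤ Y h).card * (2 * R) := by
    calc ∑ h, Y h ≤ _ := sum_le_sum fun h _ => key h
      _ = N * (R / 4) + (∑ h, Y h ^ 2) / (8 * R)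
          + (univ.filter fun h => R / 4 ≤ Y h).card * (2 * R) := by
        rw [sum_add_distrib, sum_add_distrib, ← sum_filter, sum_const, sum_const, card_univ,
          nsmul_eq_mul, nsmul_eq_mul, sum_div univ fun h => Y h ^ 2]
      _ ≤ _ := by gcongr
  have h4 : (N * R ^ 2) / (8 * R) = N * R / 8 := by field_simp
  rw [h4] at h3
  have h5 : N / 16 * (2 * R) ≤ (univ.filter fun h => R / 4 ≤ Y h).card * (2 * R) := by linarith
  exact le_of_mul_le_mul_right h5 (by positivity)

end Rademacher

/-! ### Greedy covering and the hitting family of sign patterns -/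

/-- Greedy covering: if every `u` is related to at least a fraction `p` of all `h`, then `J`
elements `h` suffice to meet all `u` in a set `T` with `#T * (1 - p) ^ J < 1`. -/
lemma exists_cover {U H : Type*} [Fintype H] (r : U → H → Prop) (p : ℝ) (hp : p ≤ 1)
    (J : ℕ) (T : Finset U) [∀ u, DecidablePred (r u)]
    (hr : ∀ u ∈ T, p * Fintype.card H ≤ (univ.filter fun h => r u h).card)
    (hH : Nonempty H) (hT : (T.card : ℝ) * (1 - p) ^ J < 1) :
    ∃ f : Fin J → H, ∀ u ∈ T, ∃ j, r u (f j) := by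
  classical
  induction J generalizing T with
  | zero =>
    have : T.card = 0 := by
      rw [pow_zero, mul_one] at hT; exact_mod_cast Nat.lt_one_iff.1 (by exact_mod_cast hT)
    rw [card_eq_zero] at this
    exact ⟨Fin.elim0, by simp [this]⟩
  | succ J ih =>
    -- Some `h` is related to at least a fraction `p` of `T`, by double counting.
    obtain ⟨h, -, hh⟩ : ∃ h ∈ (univ : Finset H),
        p * T.card ≤ ((T.filter fun u => r u h).card : ℝ) := by
      refine exists_le_of_sum_le univ_nonempty ?_
      have : ∑ h, ((T.filter fun u => r u h).card : ℝ)
          = ∑ u ∈ T, ((univ.filter fun h => r u h).card : ℝ) := by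
        simp only [card_filter, Nat.cast_sum]; exact sum_comm
      rw [this]
      calc ∑ _h : H, p * (T.card : ℝ) = ∑ _u ∈ T, p * (Fintype.card H : ℝ) := by
            simp; ring
        _ ≤ _ := sum_le_sum hr
    have hcard : ((T.filter fun u => ¬ r u h).card : ℝ) ≤ (1 - p) * T.card := by
      have := card_filter_add_card_filter_not (s := T) (fun u => r u h)
      have : ((T.filter fun u => r u h).card : ℝ) + (T.filter fun u => ¬ r u h).card = T.card := by
        exact_mod_cast this
      linarith
    obtain ⟨f, hf⟩ := ih (T.filter fun u => ¬ r u h) (fun u hu => hr u (mem_filter.1 hu).1) (by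
      refine lt_of_le_of_lt (mul_le_mul_of_nonneg_right hcard
        (pow_nonneg (sub_nonneg.2 hp) J)) ?_
      rw [pow_succ] at hT; linarith)
    refine ⟨Fin.cons h f, fun u hu => ?_⟩
    by_cases hu' : r u h
    · exact ⟨0, by simpa using hu'⟩
    · obtain ⟨j, hj⟩ := hf u (mem_filter.2 ⟨hu, hu'⟩)
      exact ⟨j.succ, by simpa using hj⟩

/-- A family of `J` sign patterns on `L` blocks of `B` coordinates such that every integer vector
with entries in `[-R, R]` has, for one of the patterns, inner products with the blocks of that
pattern whose absolute values add up to a quarter of the sum of the Euclidean norms of its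
blocks. -/
lemma exists_hitting_family (L B J R : ℕ)
    (hJ : ((2 * R + 1 : ℕ) : ℝ) ^ (L * B) * (15 / 16 : ℝ) ^ J < 1) :
    ∃ f : Fin J → Fin L × Fin B → Bool, ∀ a : Fin L × Fin B → ℤ, (∀ d, |a d| ≤ R) →
      ∃ j, (∑ l, √(∑ b, (a (l, b) : ℝ) ^ 2)) / 4
        ≤ ∑ l, |∑ b, (a (l, b) : ℝ) * sgn (f j (l, b))| := by
  classical
  obtain ⟨f, hf⟩ := exists_cover (U := Fin L × Fin B → ℤ) (H := Fin L × Fin B → Bool)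
    (fun a h => (∑ l, √(∑ b, (a (l, b) : ℝ) ^ 2)) / 4
        ≤ ∑ l, |∑ b, (a (l, b) : ℝ) * sgn (h (l, b))|) (1 / 16) (by norm_num) J
    (Fintype.piFinset fun _ => Icc (-(R : ℤ)) R) (fun a _ => by
      have := card_le_card_filter_rad (fun d => (a d : ℝ))
        (fun l : Fin L => ({l} : Finset (Fin L)) ×ˢ (univ : Finset (Fin B)))
      simp only [rad, sum_product, sum_singleton] at this
      convert this using 1
      ring) inferInstance (by
      rw [Fintype.card_piFinset]
      simp only [Int.card_Icc, prod_const, card_univ, Fintype.card_prod, Fintype.card_fin]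
      rw [show ((R : ℤ) + 1 - -(R : ℤ)).toNat = 2 * R + 1 by omega]
      rw [show (1 - 1 / 16 : ℝ) = 15 / 16 by norm_num]
      exact_mod_cast hJ)
  refine ⟨f, fun a ha => hf a (Fintype.mem_piFinset.2 fun d => mem_Icc.2 (abs_le.1 (ha d)))⟩

/-! ### The metric space attached to a sign pattern -/

/-- The distance whose `z`-th power is `2 + sgn b`, that is `3` or `1`. -/
noncomputable def rho (z : ℕ) (b : Bool) : ℝ := (2 + sgn b) ^ (z⁻¹ : ℝ)

lemma one_le_two_add_sgn (b : Bool) : 1 ≤ 2 + sgn b := by cases b <;> norm_num [sgn]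

lemma two_add_sgn_le_three (b : Bool) : 2 + sgn b ≤ 3 := by cases b <;> norm_num [sgn]

lemma one_le_rho (z : ℕ) (b : Bool) : 1 ≤ rho z b :=
  Real.one_le_rpow (one_le_two_add_sgn b) (by positivity)

lemma rho_pow {z : ℕ} (hz : 1 ≤ z) (b : Bool) : rho z b ^ z = 2 + sgn b :=
  Real.rpow_inv_natCast_pow (by linarith [one_le_two_add_sgn b]) (by omega)

lemma rho_le_three (z : ℕ) (b : Bool) : rho z b ≤ 3 := by
  rcases Nat.eq_zero_or_pos z with rfl | hz
  · norm_num [rho]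
  · refine le_of_pow_le_pow_left₀ hz.ne' (by norm_num) ?_
    rw [rho_pow hz]
    exact (two_add_sgn_le_three b).trans (le_self_pow₀ (by norm_num) hz.ne')

section Space

variable {k : ℕ} {C Q : Type} [DecidableEq C] [DecidableEq Q] {r : ℕ}

/-- The points of the hard instance: `k` clusters, each with a copy of the set `C` of clients and
a copy of the set `Q` of candidate centers, and `r` further points far away from all of them. -/
abbrev Point (k : ℕ) (C Q : Type) (r : ℕ) : Type := (Fin k × C) ⊕ (Fin k × Q) ⊕ Fin r

/-- The distance on `Point k C Q r`. Inside a cluster, the client `p` and the center `q` are at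
distance `3 ^ (1 / z)` or `1` according to `σ q p`, and points of the same kind are at
distance `2`. Different clusters are at distance `3`, and the far points at distance `100` from
all clusters. -/
noncomputable def pointDist (z : ℕ) (σ : Q → C → Bool) : Point k C Q r → Point k C Q r → ℝ
  | .inl (i, p), .inl (j, p') => if i = j then if p = p' then 0 else 2 else 3
  | .inl (i, p), .inr (.inl (j, q)) => if i = j then rho z (σ q p) else 3
  | .inr (.inl (i, q)), .inl (j, p) => if i = j then rho z (σ q p) else 3
  | .inr (.inl (i, q)), .inr (.inl (j, q')) => if i = j then if q = q' then 0 else 2 else 3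
  | .inr (.inr a), .inr (.inr b) => if a = b then 0 else 2
  | .inr (.inr _), .inl _ => 100
  | .inr (.inr _), .inr (.inl _) => 100
  | .inl _, .inr (.inr _) => 100
  | .inr (.inl _), .inr (.inr _) => 100

lemma pointDist_triangle (z : ℕ) (σ : Q → C → Bool) (x y w : Point k C Q r) :
    pointDist z σ x w ≤ pointDist z σ x y + pointDist z σ y w := by
  have h1 : ∀ q p, 1 ≤ rho z (σ q p) := fun q p => one_le_rho z _
  have h3 : ∀ q p, rho z (σ q p) ≤ 3 := fun q p => rho_le_three z _
  rcases x with ⟨i, p⟩ | ⟨i, q⟩ | a <;> rcases y with ⟨i', p'⟩ | ⟨i', q'⟩ | a' <;>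
    rcases w with ⟨i'', p''⟩ | ⟨i'', q''⟩ | a'' <;> simp only [pointDist] <;> grind

/-- `pointDist` as a metric. -/
noncomputable abbrev pointMetric (z : ℕ) (σ : Q → C → Bool) : MetricSpace (Point k C Q r) where
  dist := pointDist z σ
  dist_self x := by rcases x with ⟨i, p⟩ | ⟨i, q⟩ | a <;> simp [pointDist]
  dist_comm x y := by
    rcases x with ⟨i, p⟩ | ⟨i, q⟩ | a <;> rcases y with ⟨i', p'⟩ | ⟨i', q'⟩ | a' <;>
      simp only [pointDist] <;> grind
  dist_triangle := pointDist_triangle z σ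
  eq_of_dist_eq_zero {x y} h := by
    have h1 : ∀ q p, 1 ≤ rho z (σ q p) := fun q p => one_le_rho z _
    change pointDist z σ x y = 0 at h
    rcases x with ⟨i, p⟩ | ⟨i, q⟩ | a <;> rcases y with ⟨i', p'⟩ | ⟨i', q'⟩ | a' <;>
      simp only [pointDist] at h <;> grind

omit [DecidableEq C] [DecidableEq Q] in
/-- The cost of a point is attained at every center that is nearest to it. -/
lemma cost_eq_of_nearest {X : Type*} [MetricSpace X] (z : ℕ) (p : X) (S : Finset X) (s : X)
    (hs : s ∈ S) (h : ∀ t ∈ S, dist p s ≤ dist p t) : cost z p S = dist p s ^ z := by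
  have : Nonempty S := ⟨⟨s, hs⟩⟩
  refine le_antisymm (ciInf_le (f := fun t : S => dist p (t : X) ^ z) ?_ ⟨s, hs⟩)
    (le_ciInf fun t => pow_le_pow_left₀ dist_nonneg (h t t.2) z)
  exact ⟨0, by rintro _ ⟨t, rfl⟩; exact pow_nonneg dist_nonneg z⟩

/-- What an `(ε, k, z)`-coreset with offset `Δ` of the clients of `Point k C Q r` amounts to: the
weight function `v` on the clients, extended by zero, has to reproduce the total cost up to a
factor `1 ± ε` for every choice of one center per cluster, and for centers at distance `T`, in
the `z`-th power, from all clients. -/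
structure IsSketch [Fintype C] (ε T : ℝ) (σ : Q → C → Bool) (v : Fin k × C → ℝ)
    (Δ : ℝ) : Prop where
  nonneg : ∀ x, 0 ≤ v x
  approx : ∀ q : Fin k → Q,
    |∑ x : Fin k × C, (2 + sgn (σ (q x.1) x.2))
        - (Δ + ∑ x, v x * (2 + sgn (σ (q x.1) x.2)))|
      ≤ ε * ∑ x : Fin k × C, (2 + sgn (σ (q x.1) x.2))
  far : |∑ _x : Fin k × C, T - (Δ + ∑ x, v x * T)| ≤ ε * ∑ _x : Fin k × C, T

lemma exists_space_of_sign_pattern [Fintype C] [Fintype Q] (σ : Q → C → Bool) {z n : ℕ}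
    (hz : 1 ≤ z) (hn : k * Fintype.card C + k * Fintype.card Q + k ≤ n) :
    ∃ (X : Type) (_ : Fintype X) (_ : MetricSpace X) (P : Finset X), Fintype.card X = n ∧
      ∀ (ε : ℝ) (Ω : Finset X) (w : X → ℝ) (Δ : ℝ), IsCoreset ε k z P Ω w Δ →
        ∃ v : Fin k × C → ℝ, IsSketch ε (100 ^ z) σ v Δ ∧
          (univ.filter fun x => v x ≠ 0).card ≤ Ω.card := by
  classical
  obtain ⟨r, rfl⟩ := Nat.exists_eq_add_of_le hn
  let X := Point k C Q (k + r)
  let _ : MetricSpace X := pointMetric z σ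
  let P : Finset X := univ.map ⟨Sum.inl, Sum.inl_injective⟩
  refine ⟨X, inferInstance, inferInstance, P, ?_, fun ε Ω w Δ h => ?_⟩
  · simp [X]; ring
  let v : Fin k × C → ℝ := fun x => if (.inl x : X) ∈ Ω then w (.inl x) else 0
  have hP : ∀ f : X → ℝ, ∑ p ∈ P, f p = ∑ x : Fin k × C, f (.inl x) := fun f => by
    simp [P]
  have hΩ : ∀ f : X → ℝ, ∑ p ∈ Ω, w p * f p = ∑ x, v x * f (.inl x) := fun f => by
    have h1 : ∑ p ∈ Ω, w p * f p = ∑ p ∈ P, if p ∈ Ω then w p * f p else 0 := by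
      rw [← sum_filter, filter_mem_eq_inter, inter_eq_right.2 h.subset]
    rw [h1, hP]
    simp [v]
  have happrox := h.approx
  simp only [hP, hΩ] at happrox
  refine ⟨v, ⟨fun x => ?_, fun q => ?_, ?_⟩, ?_⟩
  · by_cases hx : (.inl x : X) ∈ Ω
    · simpa [v, hx] using h.weight_nonneg _ hx
    · simp [v, hx]
  · let S : Finset X := univ.map ⟨fun i : Fin k => (.inr (.inl (i, q i)) : X), fun i j hij => by
      simpa using congrArg (fun x : X => x.elim (fun _ => i) fun y => y.elim Prod.fst fun _ => i)
        hij⟩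
    have hS : ∀ x : Fin k × C, cost z (.inl x : X) S = 2 + sgn (σ (q x.1) x.2) := fun x => by
      have hd : ∀ i, dist (.inl x : X) (.inr (.inl (i, q i)) : X)
          = if x.1 = i then rho z (σ (q i) x.2) else 3 := fun i => rfl
      rw [cost_eq_of_nearest z (.inl x : X) S (.inr (.inl (x.1, q x.1)))
        (mem_map.2 ⟨x.1, mem_univ _, rfl⟩)]
      · rw [hd, if_pos rfl, rho_pow hz]
      · intro t ht
        obtain ⟨i, -, rfl⟩ := mem_map.1 ht
        change dist (.inl x : X) _ ≤ dist (.inl x : X) (.inr (.inl (i, q i)) : X)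
        rw [hd, hd, if_pos rfl]
        split_ifs with hi
        · rw [hi]
        · exact rho_le_three _ _
    have := happrox S (by simp [S])
    simpa only [hS] using this
  · rcases Nat.eq_zero_or_pos k with rfl | hk
    · simpa using happrox ∅ rfl
    let S : Finset X := univ.map ⟨fun i : Fin k => (.inr (.inr (Fin.castAdd r i)) : X),
      fun i j hij => Fin.castAdd_injective k r (Sum.inr_injective (Sum.inr_injective hij))⟩
    have hS : ∀ x : Fin k × C, cost z (.inl x : X) S = 100 ^ z := fun x => by
      have hd : ∀ t ∈ S, dist (.inl x : X) t = 100 := fun t ht => by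
        obtain ⟨i, -, rfl⟩ := mem_map.1 ht
        rfl
      have h0 : (.inr (.inr (Fin.castAdd r ⟨0, hk⟩)) : X) ∈ S := mem_map.2 ⟨⟨0, hk⟩, by simp, rfl⟩
      rw [cost_eq_of_nearest z (.inl x : X) S _ h0 fun t ht => (by rw [hd _ h0, hd t ht]),
        hd _ h0]
    have := happrox S (by simp [S])
    simpa only [hS] using this
  · refine card_le_card_of_injOn (fun x => (.inl x : X)) (fun x hx => ?_)
      (Sum.inl_injective.injOn)
    by_contra hx'
    exact (mem_filter.1 (mem_coe.1 hx)).2 (if_neg hx')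

end Space

/-! ### Lower bounds on the support of a sketch -/

section Sketch

variable {k : ℕ} {C Q : Type} [Fintype C] {σ : Q → C → Bool} {v : Fin k × C → ℝ} {ε T Δ : ℝ}

lemma card_le_sum_two_add_sgn (g : Fin k × C → Bool) :
    (k * Fintype.card C : ℝ) ≤ ∑ x, (2 + sgn (g x)) := by
  have := card_nsmul_le_sum univ (fun x => 2 + sgn (g x)) 1 fun x _ => one_le_two_add_sgn (g x)
  simpa using this

lemma sum_two_add_sgn_le (g : Fin k × C → Bool) :
    ∑ x, (2 + sgn (g x)) ≤ 3 * (k * Fintype.card C : ℝ) := by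
  have := sum_le_card_nsmul univ (fun x => 2 + sgn (g x)) 3 fun x _ => two_add_sgn_le_three (g x)
  simp only [card_univ, Fintype.card_prod, Fintype.card_fin, nsmul_eq_mul, Nat.cast_mul] at this
  linarith

lemma IsSketch.mono {ε' : ℝ} (h : IsSketch ε T σ v Δ) (hT : 0 ≤ T) (hε : ε ≤ ε') :
    IsSketch ε' T σ v Δ where
  nonneg := h.nonneg
  approx q := (h.approx q).trans <| mul_le_mul_of_nonneg_right hε <|
    sum_nonneg fun x _ => by linarith [one_le_two_add_sgn (σ (q x.1) x.2)]
  far := h.far.trans <| mul_le_mul_of_nonneg_right hε <| sum_nonneg fun x _ => hT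

lemma IsSketch.far' (h : IsSketch ε T σ v Δ) :
    |k * Fintype.card C * T - (Δ + (∑ x, v x) * T)| ≤ ε * (k * Fintype.card C * T) := by
  have := h.far
  simpa [← sum_mul] using this

/-- When all sign patterns are available, even a sketch with `ε = 1 / 2` has linear support. If
the clients in the support are at distance `1` and all others at distance `3`, and the other way
round, then the sketch orders the two total costs the wrong way; with the allowed error this forces
the total weight of the sketch to be at most twice the size of its support. The far centers show that the total weight is proportional to the number of
all clients. -/
lemma IsSketch.card_le_five_mul (h : IsSketch (1 / 2) T σ v Δ) (hT : 100 ≤ T)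
    (hσ : ∀ g : C → Bool, ∃ q, ∀ p, σ q p = g p) :
    (k * Fintype.card C : ℝ) ≤ 5 * (univ.filter fun x => v x ≠ 0).card := by
  classical
  set s : ℝ := ((univ.filter fun x => v x ≠ 0).card : ℝ) with hs
  set N : ℝ := k * Fintype.card C with hN
  set W := ∑ x, v x with hW
  have hs0 : 0 ≤ s := by positivity
  have hN0 : 0 ≤ N := by positivity
  choose q1 hq1 using fun i => hσ fun p => decide (v (i, p) = 0)
  choose q2 hq2 using fun i => hσ fun p => decide (v (i, p) ≠ 0)
  have hsum : ∑ x, (if v x ≠ 0 then 1 else 0 : ℝ) = s := by rw [hs, card_filter]; push_cast; rfl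
  have hcard : ∑ _x : Fin k × C, (1 : ℝ) = N := by simp [hN]
  have e1 : ∑ x : Fin k × C, (2 + sgn (σ (q1 x.1) x.2)) = 3 * N - 2 * s := by
    rw [← hsum, ← hcard, mul_sum, mul_sum, ← sum_sub_distrib]
    refine sum_congr rfl fun x _ => ?_
    rw [hq1]
    by_cases hx : v x = 0 <;> simp [hx, sgn] <;> norm_num
  have e2 : ∑ x : Fin k × C, (2 + sgn (σ (q2 x.1) x.2)) = N + 2 * s := by
    rw [← hsum, ← hcard, mul_sum, ← sum_add_distrib]
    refine sum_congr rfl fun x _ => ?_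
    rw [hq2]
    by_cases hx : v x = 0 <;> simp [hx, sgn] <;> norm_num
  have g1 : ∑ x : Fin k × C, v x * (2 + sgn (σ (q1 x.1) x.2)) = W := by
    refine sum_congr rfl fun x _ => ?_
    rw [hq1]
    by_cases hx : v x = 0 <;> simp [hx, sgn]
    norm_num
  have g2 : ∑ x : Fin k × C, v x * (2 + sgn (σ (q2 x.1) x.2)) = 3 * W := by
    rw [hW, mul_sum]
    refine sum_congr rfl fun x _ => ?_
    rw [hq2]
    by_cases hx : v x = 0 <;> simp [hx, sgn]
    ring
  have h1 := h.approx q1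
  have h2 := h.approx q2
  have h3 := h.far'
  rw [e1, g1] at h1
  rw [e2, g2] at h2
  rw [← hN, ← hW] at h3
  rw [abs_le] at h1 h2 h3
  have hWs : W ≤ 2 * s := by linarith
  have hΔ : Δ ≤ 3 / 2 * N + 3 * s := by
    have : 0 ≤ W := sum_nonneg fun x _ => h.nonneg x
    linarith
  have h4 : N * T / 2 ≤ 3 / 2 * N + 3 * s + 2 * s * T := by
    have : W * T ≤ 2 * s * T := mul_le_mul_of_nonneg_right hWs (by linarith)
    linarith
  have h5 : 100 * N ≤ N * T := by nlinarith
  have h6 : 100 * s ≤ s * T := by nlinarith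
  have h7 : N * T ≤ 5 * s * T := by linarith
  exact le_of_mul_le_mul_right h7 (by linarith)

/-- The far centers bound the total weight of a sketch; the offset is bounded below by the
comparison with any choice of centers in the clusters. -/
lemma IsSketch.sum_le [Nonempty Q] (h : IsSketch ε T σ v Δ) (hT : 100 ≤ T) (hε : ε ≤ 1 / 2) :
    ∑ x, v x ≤ 2 * (k * Fintype.card C : ℝ) := by
  set N : ℝ := k * Fintype.card C with hN
  set W := ∑ x, v x with hW
  have hN0 : 0 ≤ N := by positivity
  let q : Fin k → Q := fun _ => Classical.arbitrary Q
  have h1 := (abs_le.1 (h.approx q)).2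
  have h3 := (abs_le.1 h.far').1
  have hF := card_le_sum_two_add_sgn fun x : Fin k × C => σ (q x.1) x.2
  rw [← hN] at h3 hF
  rw [← hW] at h3
  have hG : ∑ x : Fin k × C, v x * (2 + sgn (σ (q x.1) x.2)) ≤ 3 * W := by
    rw [hW, mul_sum]
    refine sum_le_sum fun x _ => ?_
    rw [mul_comm]
    exact mul_le_mul_of_nonneg_right (two_add_sgn_le_three _) (h.nonneg x)
  have hεF := mul_le_mul_of_nonneg_right hε (hN0.trans hF)
  have hεN := mul_le_mul_of_nonneg_right hε (mul_nonneg hN0 (by linarith : 0 ≤ T))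
  have hW0 : 0 ≤ W := sum_nonneg fun x _ => h.nonneg x
  have h5 : 100 * W ≤ W * T := by nlinarith
  have h7 : W * T ≤ 2 * N * T := by linarith
  exact le_of_mul_le_mul_right h7 (by linarith)

end Sketch

/-- The sign patterns of the hard instance: a pattern `f j` of the given family, in which the sign
of every block `l` may be chosen freely. -/
def blockPattern {L B J : ℕ} (f : Fin J → Fin L × Fin B → Bool) :
    Fin J × (Fin L → Bool) → Fin L × Fin B → Bool :=
  fun q d => q.2 d.1 == f q.1 d

/-- With blocks of a single client, the sign patterns are arbitrary. -/
lemma exists_blockPattern_eq {L J : ℕ} (hJ : 1 ≤ J) (f : Fin J → Fin L × Fin 1 → Bool)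
    (g : Fin L × Fin 1 → Bool) : ∃ q, ∀ p, blockPattern f q p = g p := by
  refine ⟨(⟨0, hJ⟩, fun l => g (l, 0) == f ⟨0, hJ⟩ (l, 0)), fun ⟨l, b⟩ => ?_⟩
  obtain rfl := Subsingleton.elim 0 b
  simp only [blockPattern]
  cases g (l, 0) <;> cases f ⟨0, hJ⟩ (l, 0) <;> rfl

/-- For blocks of size `B ≤ (50 ε)⁻²` and a hitting family, an `ε`-sketch keeps at least half of
the clients. Write `u = 1 - v`, so that `u = 1` outside the support. The hitting family contains
for each cluster a pattern whose inner products with the blocks of `u` add up to the order of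
`√B` per block. Switching the signs of the blocks from those of the inner products to their
opposites changes the error of the sketch by twice this amount, while the sketch allows only a
change of order `ε B` per block. -/
lemma IsSketch.card_le_two_mul {k L B J R : ℕ} {f : Fin J → Fin L × Fin B → Bool} {ε T Δ : ℝ}
    {v : Fin k × (Fin L × Fin B) → ℝ} (h : IsSketch ε T (blockPattern f) v Δ) (hT : 100 ≤ T)
    (hk : 1 ≤ k) (hL : 1 ≤ L) (hB : 1 ≤ B) (hε0 : 0 < ε) (hεB : 50 * ε * √B ≤ 1)
    (hR : 32 * k * L * B ^ 2 ≤ R)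
    (hf : ∀ a : Fin L × Fin B → ℤ, (∀ d, |a d| ≤ R) →
      ∃ j, (∑ l, √(∑ b, (a (l, b) : ℝ) ^ 2)) / 4
        ≤ ∑ l, |∑ b, (a (l, b) : ℝ) * sgn (f j (l, b))|) :
    (k * (L * B) : ℝ) ≤ 2 * (univ.filter fun x => v x ≠ 0).card := by
  classical
  have : Nonempty (Fin J × (Fin L → Bool)) := by
    obtain ⟨j, -⟩ := hf 0 (fun d => by simp)
    exact ⟨(j, fun _ => true)⟩
  set s : ℝ := ((univ.filter fun x => v x ≠ 0).card : ℝ) with hs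
  set N : ℝ := k * (L * B) with hN
  set t : ℝ := √B with ht
  have hB1 : (1 : ℝ) ≤ B := by exact_mod_cast hB
  have hL1 : (1 : ℝ) ≤ L := by exact_mod_cast hL
  have hk1 : (1 : ℝ) ≤ k := by exact_mod_cast hk
  have htB : t ^ 2 = B := Real.sq_sqrt (by positivity)
  have ht1 : 1 ≤ t := Real.one_le_sqrt.2 hB1
  have hN1 : 1 ≤ N := by
    rw [hN]; exact one_le_mul_of_one_le_of_one_le hk1 (one_le_mul_of_one_le_of_one_le hL1 hB1)
  have hcardC : (k * Fintype.card (Fin L × Fin B) : ℝ) = N := by simp [hN]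
  have hε1 : ε ≤ 1 / 2 := by nlinarith
  -- The coefficients `u = 1 - v`, rounded down to multiples of `1 / K`.
  set K : ℝ := 16 * B with hK
  have hK0 : 0 < K := by positivity
  let u : Fin k × (Fin L × Fin B) → ℝ := fun x => 1 - v x
  let a : Fin k → Fin L × Fin B → ℤ := fun i d => ⌊u (i, d) * K⌋
  have hvN : ∀ x, v x ≤ 2 * N := fun x =>
    (single_le_sum (fun y _ => h.nonneg y) (mem_univ x)).trans (hcardC ▸ h.sum_le hT hε1)
  have haR : ∀ i d, |a i d| ≤ R := fun i d => by
    have hRK : 2 * N * K ≤ R := by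
      rw [hN, hK]
      calc 2 * (k * (L * B) : ℝ) * (16 * B) = ((32 * k * L * B ^ 2 : ℕ) : ℝ) := by push_cast; ring
        _ ≤ R := by exact_mod_cast hR
    have h0 := h.nonneg (i, d)
    have h2 := hvN (i, d)
    rw [abs_le]
    constructor
    · refine Int.le_floor.2 ?_
      push_cast
      have : (-2 * N) * K ≤ u (i, d) * K :=
        mul_le_mul_of_nonneg_right (by simp only [u]; linarith) hK0.le
      linarith
    · have h3 : (a i d : ℝ) ≤ u (i, d) * K := Int.floor_le _
      have : u (i, d) * K ≤ (2 * N) * K :=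
        mul_le_mul_of_nonneg_right (by simp only [u]; linarith) hK0.le
      exact_mod_cast h3.trans (this.trans hRK)
  choose j hj using fun i => hf (a i) (haR i)
  let X : Fin k → Fin L → ℝ := fun i l => ∑ b, u (i, (l, b)) * sgn (f (j i) (l, b))
  choose σ hσ using fun i l => exists_sgn_mul_eq_abs (X i l)
  -- Comparison of the two choices of block signs bounds the inner products from above.
  have hE : ∀ τ : Fin k → Fin L → Bool,
      |2 * ∑ x, u x + ∑ i, ∑ l, sgn (τ i l) * X i l - Δ| ≤ 3 * ε * N := fun τ => by
    have h1 := h.approx fun i => (j i, τ i)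
    have h2 := sum_two_add_sgn_le fun x : Fin k × (Fin L × Fin B) =>
      blockPattern f (j x.1, τ x.1) x.2
    rw [hcardC] at h2
    have h3 := h1.trans (mul_le_mul_of_nonneg_left h2 hε0.le)
    have h4 : ∑ i, ∑ l, sgn (τ i l) * X i l
        = ∑ x : Fin k × (Fin L × Fin B), u x * sgn (blockPattern f (j x.1, τ x.1) x.2) := by
      simp only [Fintype.sum_prod_type, X, mul_sum, blockPattern, sgn_beq]
      exact sum_congr rfl fun i _ => sum_congr rfl fun l _ => sum_congr rfl fun b _ => by ring
    have h5 : 2 * ∑ x, u x + ∑ i, ∑ l, sgn (τ i l) * X i l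
        = ∑ x : Fin k × (Fin L × Fin B), (2 + sgn (blockPattern f (j x.1, τ x.1) x.2))
          - ∑ x, v x * (2 + sgn (blockPattern f (j x.1, τ x.1) x.2)) := by
      rw [h4, mul_sum, ← sum_add_distrib, ← sum_sub_distrib]
      exact sum_congr rfl fun x _ => by simp only [u]; ring
    rw [h5]
    calc _ = _ := by congr 1; ring
      _ ≤ _ := h3
      _ = _ := by ring
  have hupper : ∑ i, ∑ l, |X i l| ≤ 3 * ε * N := by
    have h1 := (abs_le.1 (hE σ)).2
    have h2 := (abs_le.1 (hE fun i l => !σ i l)).1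
    simp only [sgn_not, neg_mul, sum_neg_distrib, hσ] at h1 h2
    linarith
  -- The hitting property bounds them from below.
  let c : Fin k → Fin L → ℝ := fun i l => ∑ b, if v (i, (l, b)) ≠ 0 then 0 else 1
  have hround : ∀ i l, |∑ b, (a i (l, b) : ℝ) * sgn (f (j i) (l, b))| / K - 1 / 16 ≤ |X i l| :=
    fun i l => by
      have h1 : |∑ b, (a i (l, b) : ℝ) * sgn (f (j i) (l, b)) - K * X i l| ≤ B := by
        rw [mul_sum, ← sum_sub_distrib]
        refine (abs_sum_le_sum_abs _ _).trans ?_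
        calc _ ≤ ∑ _b : Fin B, (1 : ℝ) := sum_le_sum fun b _ => by
              have h2 := Int.floor_le (u (i, (l, b)) * K)
              have h3 := Int.lt_floor_add_one (u (i, (l, b)) * K)
              rw [show (a i (l, b) : ℝ) * sgn (f (j i) (l, b))
                - K * (u (i, (l, b)) * sgn (f (j i) (l, b)))
                = (a i (l, b) - u (i, (l, b)) * K) * sgn (f (j i) (l, b)) by ring, abs_mul,
                abs_sgn, mul_one, abs_le]
              constructor <;> simp only [a] <;> linarith
          _ = B := by simp
      have h2 := abs_sub_abs_le_abs_sub (∑ b, (a i (l, b) : ℝ) * sgn (f (j i) (l, b))) (K * X i l)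
      rw [abs_mul, abs_of_pos hK0] at h2
      rw [sub_le_iff_le_add, div_le_iff₀ hK0, hK]
      rw [hK] at h1 h2
      linarith
  have hnorm : ∀ i l, K * (c i l / t) ≤ √(∑ b, (a i (l, b) : ℝ) ^ 2) := fun i l => by
    refine Real.le_sqrt_of_sq_le ?_
    have h1 : c i l ^ 2 ≤ B * ∑ b, (if v (i, (l, b)) ≠ 0 then (0 : ℝ) else 1) ^ 2 := by
      have := sq_sum_le_card_mul_sum_sq (s := (univ : Finset (Fin B)))
        (f := fun b => if v (i, (l, b)) ≠ 0 then (0 : ℝ) else 1)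
      rwa [card_univ, Fintype.card_fin] at this
    have h2 : K ^ 2 * ∑ b, (if v (i, (l, b)) ≠ 0 then (0 : ℝ) else 1) ^ 2
        ≤ ∑ b, (a i (l, b) : ℝ) ^ 2 := by
      rw [mul_sum]
      refine sum_le_sum fun b _ => ?_
      by_cases hv : v (i, (l, b)) = 0
      · have : a i (l, b) = ((16 * B : ℕ) : ℤ) := by
          simp only [a, u, hv, sub_zero, one_mul, hK]
          exact_mod_cast Int.floor_natCast (16 * B)
        rw [this, hK]; simp [hv]
      · simp [hv]; positivity
    have ht0 : 0 < t := by linarith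
    calc (K * (c i l / t)) ^ 2 = K ^ 2 * (c i l ^ 2 / t ^ 2) := by ring
      _ ≤ K ^ 2 * ∑ b, (if v (i, (l, b)) ≠ 0 then (0 : ℝ) else 1) ^ 2 := by
          gcongr
          rw [div_le_iff₀ (by positivity), htB, mul_comm]
          exact h1
      _ ≤ _ := h2
  have hlower : ∀ i, (∑ l, c i l) / (4 * t) - L / 16 ≤ ∑ l, |X i l| := fun i => by
    calc (∑ l, c i l) / (4 * t) - L / 16 = (∑ l, K * (c i l / t)) / 4 / K - L / 16 := by
          rw [← mul_sum, ← sum_div]; field_simp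
      _ ≤ (∑ l, √(∑ b, (a i (l, b) : ℝ) ^ 2)) / 4 / K - L / 16 := by
          gcongr with l; exact hnorm i l
      _ ≤ (∑ l, |∑ b, (a i (l, b) : ℝ) * sgn (f (j i) (l, b))|) / K - L / 16 := by
          gcongr; exact hj i
      _ = ∑ l, (|∑ b, (a i (l, b) : ℝ) * sgn (f (j i) (l, b))| / K - 1 / 16) := by
          rw [sum_sub_distrib, sum_div]; simp; ring
      _ ≤ _ := sum_le_sum fun l _ => hround i l
  have hcs : ∑ i, ∑ l, c i l = N - s := by
    have h1 : s = ∑ x, (if v x ≠ 0 then 1 else 0 : ℝ) := by rw [hs, card_filter]; push_cast; rfl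
    have h2 : N = ∑ _x : Fin k × (Fin L × Fin B), (1 : ℝ) := by simp [hN]
    rw [h1, h2, ← sum_sub_distrib]
    simp only [c, Fintype.sum_prod_type]
    exact sum_congr rfl fun i _ => sum_congr rfl fun l _ => sum_congr rfl fun b _ => by
      split_ifs <;> norm_num
  have hfin : (N - s) / (4 * t) - k * (L / 16) ≤ 3 * ε * N := by
    refine le_trans ?_ hupper
    calc _ = ∑ i, ((∑ l, c i l) / (4 * t) - L / 16) := by
          rw [sum_sub_distrib, ← sum_div, hcs]; simp
      _ ≤ _ := sum_le_sum fun i _ => hlower i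
  have hkL : k * (L / 16 : ℝ) * t ≤ N / 16 := by
    have : t ≤ B := by nlinarith
    calc k * (L / 16 : ℝ) * t ≤ k * (L / 16 : ℝ) * B := by gcongr
      _ = N / 16 := by rw [hN]; ring
  have h8 : (N - s) / 4 ≤ 3 * ε * N * t + k * (L / 16) * t := by
    have ht0 : 0 < t := by linarith
    have := mul_le_mul_of_nonneg_right hfin ht0.le
    rw [sub_mul, show (N - s) / (4 * t) * t = (N - s) / 4 by field_simp] at this
    linarith
  have h9 : 3 * ε * N * t ≤ 3 / 50 * N := by nlinarith
  linarith

/-! ### Choice of parameters -/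

lemma eventually_large {α : ℝ} (hα : 0 < α) :
    ∃ n₀ : ℕ, ∀ n : ℕ, n₀ ≤ n → 9 ≤ n ∧ 8 / α ≤ Real.log n ∧
      83 * Real.log n ^ 2 ≤ (n : ℝ) ^ (3 * α / 4) := by
  have h1 : ∀ᶠ x : ℝ in atTop, 8 / α ≤ Real.log x :=
    Real.tendsto_log_atTop.eventually_ge_atTop _
  have h2 : ∀ᶠ x : ℝ in atTop, 83 * Real.log x ^ 2 ≤ x ^ (3 * α / 4) := by
    have := (isLittleO_log_rpow_rpow_atTop 2 (by positivity : 0 < 3 * α / 4)).bound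
      (by norm_num : (0 : ℝ) < 1 / 83)
    filter_upwards [this, eventually_ge_atTop 1] with x hx hx1
    rw [Real.norm_of_nonneg (by have := Real.log_nonneg hx1; positivity),
      Real.norm_of_nonneg (by positivity), Real.rpow_two] at hx
    linarith
  have h3 := tendsto_natCast_atTop_atTop (R := ℝ) |>.eventually (h1.and h2)
  obtain ⟨n₀, hn₀⟩ := eventually_atTop.1 ((eventually_ge_atTop 9).and h3)
  exact ⟨n₀, fun n hn => ⟨(hn₀ n hn).1, (hn₀ n hn).2.1, (hn₀ n hn).2.2⟩⟩

/-- A hitting family exists with few enough patterns for the hard instance to fit into `n`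
points. There are of order `log n` blocks per cluster, so that the choices of the block signs
multiply the number of patterns by a small power of `n` only, and of order
`B (log n) ^ 2` patterns suffice for the hitting property. -/
lemma exists_parameters {α : ℝ} (hα : 0 < α) (hα1 : α ≤ 1 / 2) {n k B : ℕ} (hn : 9 ≤ n)
    (hlog : 8 / α ≤ Real.log n) (hpow : 83 * Real.log n ^ 2 ≤ (n : ℝ) ^ (3 * α / 4))
    (hk : 1 ≤ k) (hB : 1 ≤ B) (hkB : (k * B : ℝ) ≤ (n : ℝ) ^ (1 - α)) :
    ∃ (L J : ℕ) (f : Fin J → Fin L × Fin B → Bool), 1 ≤ L ∧ 1 ≤ J ∧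
      α / 8 * Real.log n ≤ L ∧ k * (L * B) + k * (J * 2 ^ L) + k ≤ n ∧
      ∀ a : Fin L × Fin B → ℤ, (∀ d, |a d| ≤ (32 * k * L * B ^ 2 : ℕ)) →
        ∃ j, (∑ l, √(∑ b, (a (l, b) : ℝ) ^ 2)) / 4
          ≤ ∑ l, |∑ b, (a (l, b) : ℝ) * sgn (f j (l, b))| := by
  set x := Real.log n with hx
  have hn9 : (9 : ℝ) ≤ n := by exact_mod_cast hn
  have hn0 : (0 : ℝ) < n := by linarith
  have hn1 : (1 : ℝ) ≤ n := by linarith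
  have hk1 : (1 : ℝ) ≤ k := by exact_mod_cast hk
  have hB1 : (1 : ℝ) ≤ B := by exact_mod_cast hB
  have hαx : 8 ≤ α * x := by rwa [div_le_iff₀ hα, mul_comm] at hlog
  have hx1 : 1 ≤ x := by nlinarith
  have hxn : x ≤ n := (Real.log_le_sub_one_of_pos hn0).trans (by linarith)
  set L := ⌊α / 4 * x⌋₊ with hL
  have hLle : (L : ℝ) ≤ α / 4 * x := Nat.floor_le (by positivity)
  have hLlt : α / 4 * x < L + 1 := Nat.lt_floor_add_one _
  have hLge : α / 8 * x ≤ L := by linarith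
  have hL1 : (1 : ℝ) ≤ L := by linarith
  have hLx : (L : ℝ) ≤ x := by nlinarith
  set J := ⌊80 * (L * B) * x⌋₊ + 1 with hJ
  have hJle : (J : ℝ) ≤ 81 * B * x ^ 2 := by
    have h1 : (J : ℝ) ≤ 80 * (L * B) * x + 1 := by
      rw [hJ]; push_cast; gcongr; exact Nat.floor_le (by positivity)
    have h2 : (L * B : ℝ) * x ≤ x * B * x := by gcongr
    have h3 : 1 ≤ x * B * x :=
      one_le_mul_of_one_le_of_one_le (one_le_mul_of_one_le_of_one_le hx1 hB1) hx1
    nlinarith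
  have hJgt : 80 * (L * B) * x < J := by rw [hJ]; push_cast; exact Nat.lt_floor_add_one _
  have hkBn : (k * B : ℝ) ≤ n := hkB.trans <| by
    simpa using Real.rpow_le_rpow_of_exponent_le hn1 (by linarith : 1 - α ≤ 1)
  have hBn : (B : ℝ) ≤ n := by nlinarith
  obtain ⟨f, hf⟩ := exists_hitting_family L B J (32 * k * L * B ^ 2) (by
    have h1 : ((2 * (32 * k * L * B ^ 2) + 1 : ℕ) : ℝ) ≤ (n : ℝ) ^ 5 := by
      have h2 : (k * B : ℝ) * L * B ≤ n * n * n := by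
        have hLn : (L : ℝ) ≤ n := hLx.trans hxn
        gcongr ?_ * ?_ * ?_
      push_cast
      have h3 : (n : ℝ) ^ 5 = n ^ 2 * (n * n * n) := by ring
      have h4 : (81 : ℝ) ≤ n ^ 2 := by nlinarith
      have h5 : (1 : ℝ) ≤ n * n * n := by
        exact one_le_mul_of_one_le_of_one_le (one_le_mul_of_one_le_of_one_le hn1 hn1) hn1
      have h6 : 81 * (n * n * n : ℝ) ≤ n ^ 2 * (n * n * n) := by gcongr
      rw [h3]
      linarith
    calc _ ≤ ((n : ℝ) ^ 5) ^ (L * B) * Real.exp (-1 / 16) ^ J := by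
          gcongr
          have := Real.add_one_le_exp (-1 / 16 : ℝ)
          linarith
      _ = Real.exp (5 * (L * B) * x - J / 16) := by
          rw [← Real.exp_log hn0, ← hx, ← Real.exp_nat_mul, ← Real.exp_nat_mul,
            ← Real.exp_nat_mul, ← Real.exp_add]
          congr 1
          push_cast
          ring
      _ < 1 := (Real.exp_lt_exp.2 (by linarith)).trans_eq Real.exp_zero)
  refine ⟨L, J, f, by exact_mod_cast hL1, by omega, hLge, ?_, hf⟩
  have h2L : (2 : ℝ) ^ L ≤ (n : ℝ) ^ (α / 4) := by
    rw [Real.rpow_def_of_pos hn0, ← hx]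
    calc (2 : ℝ) ^ L ≤ Real.exp 1 ^ L := by
          gcongr
          have := Real.add_one_le_exp (1 : ℝ)
          linarith
      _ = Real.exp L := by rw [← Real.exp_nat_mul, mul_one]
      _ ≤ _ := Real.exp_le_exp.2 (by linarith)
  have hp1 : 1 ≤ (n : ℝ) ^ (α / 4) := Real.one_le_rpow hn1 (by positivity)
  set y := (n : ℝ) ^ (α / 4) with hy
  have hreal : (k * (L * B) + k * (J * 2 ^ L) + k : ℝ) ≤ n := by
    have hxy : x ≤ x ^ 2 * y := by
      calc x = x * 1 * 1 := by ring
        _ ≤ x * x * y := by gcongr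
        _ = x ^ 2 * y := by ring
    have h1 : (k * (L * B) : ℝ) ≤ k * B * (x ^ 2 * y) := by
      calc (k * (L * B) : ℝ) = k * B * L := by ring
        _ ≤ _ := by gcongr; exact hLx.trans hxy
    have h2 : (k * (J * 2 ^ L) : ℝ) ≤ 81 * (k * B * (x ^ 2 * y)) := by
      calc (k * (J * 2 ^ L) : ℝ) ≤ k * (81 * B * x ^ 2 * y) := by gcongr
        _ = _ := by ring
    have h3 : (k : ℝ) ≤ k * B * (x ^ 2 * y) := by
      calc (k : ℝ) = k * 1 * 1 := by ring
        _ ≤ _ := by gcongr; exact hx1.trans hxy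
    calc (k * (L * B) + k * (J * 2 ^ L) + k : ℝ) ≤ k * B * (83 * x ^ 2 * y) := by linarith
      _ ≤ (n : ℝ) ^ (1 - α) * ((n : ℝ) ^ (3 * α / 4) * y) := by gcongr
      _ = n := by
          rw [hy, ← Real.rpow_add hn0, ← Real.rpow_add hn0]
          ring_nf
          simp
  exact_mod_cast hreal

/-- A coreset of a single client is nonempty: the offset alone cannot account for both a cost of
zero and a positive cost. -/
lemma IsCoreset.nonempty_of_singleton {X : Type*} [Fintype X] [MetricSpace X] {ε Δ : ℝ}
    {k z : ℕ} {p : X} {Ω : Finset X} {w : X → ℝ} (h : IsCoreset ε k z {p} Ω w Δ) (hε : ε < 1)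
    (hk : 1 ≤ k) (hz : 1 ≤ z) (hX : k < Fintype.card X) : Ω.Nonempty := by
  classical
  rw [nonempty_iff_ne_empty]
  rintro rfl
  obtain ⟨S, hpS, -, hS⟩ := exists_subsuperset_card_eq (singleton_subset_iff.2 (mem_univ p))
    (by simpa using hk) (by simpa using hX.le)
  obtain ⟨S', hS'p, hS'⟩ := exists_subset_card_eq (s := univ.erase p) (n := k)
    (by rw [card_erase_of_mem (mem_univ p), card_univ]; omega)
  have h1 := h.approx S hS
  have h2 := h.approx S' hS'
  have hc : cost z p S = 0 := by
    rw [cost_eq_of_nearest z p S p (singleton_subset_iff.1 hpS) fun t _ => by simp, dist_self,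
      zero_pow (by omega)]
  obtain ⟨s, hs, hmin⟩ := exists_min_image S' (fun t => dist p t)
    (card_pos.1 (by omega))
  have hc' : 0 < cost z p S' := by
    rw [cost_eq_of_nearest z p S' s hs hmin]
    exact pow_pos (dist_pos.2 (ne_of_mem_erase (hS'p hs)).symm) z
  simp only [sum_singleton, sum_empty, hc, add_zero, mul_zero, zero_sub, abs_neg,
    abs_nonpos_iff] at h1
  simp only [sum_singleton, sum_empty, add_zero, h1, sub_zero, abs_of_pos hc'] at h2
  nlinarith

/-- The lower bound for large `n`, with blocks of size `⌊(50 ε)⁻²⌋` if `ε ≤ 1 / 50` and of size `1`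
otherwise. -/
lemma exists_space_of_large {α : ℝ} (hα : 0 < α) (hα1 : α ≤ 1 / 2) {n k z : ℕ} {ε : ℝ}
    (hn : 9 ≤ n) (hlog : 8 / α ≤ Real.log n)
    (hpow : 83 * Real.log n ^ 2 ≤ (n : ℝ) ^ (3 * α / 4)) (hε : 0 < ε) (hε2 : ε < 1 / 2)
    (hk : 1 ≤ k) (hz : 1 ≤ z) (hkn : (k : ℝ) * (1 / ε) ^ 2 ≤ (n : ℝ) ^ (1 - α)) :
    ∃ (X : Type) (_ : Fintype X) (_ : MetricSpace X) (P : Finset X), Fintype.card X = n ∧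
      ∀ (Ω : Finset X) (w : X → ℝ) (Δ : ℝ), IsCoreset ε k z P Ω w Δ →
        α / 100000 * ((k : ℝ) * (1 / ε) ^ 2 * Real.log (n : ℝ)) ≤ (Ω.card : ℝ) := by
  have hlog0 : 0 ≤ Real.log n := Real.log_natCast_nonneg n
  have hT : (100 : ℝ) ≤ 100 ^ z := le_self_pow₀ (by norm_num) (by omega)
  rcases lt_or_ge (1 / 50) ε with h50 | h50
  · have he : (1 / ε) ^ 2 ≤ 2500 := by
      have : 1 / ε ≤ 50 := by rw [div_le_iff₀ hε]; linarith
      calc (1 / ε) ^ 2 ≤ 50 ^ 2 := by gcongr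
        _ = 2500 := by norm_num
    have he1 : 1 ≤ (1 / ε) ^ 2 := one_le_pow₀ (by rw [le_div_iff₀ hε]; linarith)
    obtain ⟨L, J, f, hL, hJ, hLn, hcard, -⟩ := exists_parameters hα hα1 hn hlog hpow hk le_rfl (by
      refine le_trans ?_ hkn
      push_cast
      gcongr)
    obtain ⟨X, i1, i2, P, hX, h⟩ := exists_space_of_sign_pattern (k := k) (blockPattern f) (n := n)
      hz (by simpa using hcard)
    refine ⟨X, i1, i2, P, hX, fun Ω w Δ hΩ => ?_⟩
    obtain ⟨v, hv, hvΩ⟩ := h ε Ω w Δ hΩ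
    have h5 := (hv.mono (by positivity) hε2.le).card_le_five_mul hT (exists_blockPattern_eq hJ f)
    have hvΩ' : ((univ.filter fun x => v x ≠ 0).card : ℝ) ≤ Ω.card := by exact_mod_cast hvΩ
    have h6 : (k * L : ℝ) ≤ 5 * Ω.card := by
      refine le_trans ?_ (h5.trans (by gcongr))
      simp
    calc α / 100000 * ((k : ℝ) * (1 / ε) ^ 2 * Real.log n)
        ≤ α / 100000 * ((k : ℝ) * 2500 * Real.log n) := by gcongr
      _ = k * (α / 8 * Real.log n) / 5 := by ring
      _ ≤ k * L / 5 := by gcongr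
      _ ≤ Ω.card := by linarith
  · set B := ⌊(1 / (50 * ε)) ^ 2⌋₊ with hB
    have h1 : 1 ≤ 1 / (50 * ε) := by rw [le_div_iff₀ (by positivity)]; linarith
    have hBle : (B : ℝ) ≤ (1 / (50 * ε)) ^ 2 := Nat.floor_le (by positivity)
    have hB1 : 1 ≤ B := Nat.le_floor (by rw [Nat.cast_one]; exact one_le_pow₀ h1)
    have hB1' : (1 : ℝ) ≤ B := by exact_mod_cast hB1
    have hBge : (1 / ε) ^ 2 / 5000 ≤ B := by
      have h2 : (1 / (50 * ε)) ^ 2 < B + 1 := Nat.lt_floor_add_one _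
      have h3 : (1 / (50 * ε)) ^ 2 = (1 / ε) ^ 2 / 2500 := by field_simp; norm_num
      linarith
    have hsqrt : 50 * ε * √B ≤ 1 := by
      have h2 : √B ≤ 1 / (50 * ε) := Real.sqrt_le_iff.2 ⟨by positivity, hBle⟩
      rwa [le_div_iff₀ (by positivity), mul_comm] at h2
    obtain ⟨L, J, f, hL, hJ, hLn, hcard, hf⟩ := exists_parameters hα hα1 hn hlog hpow hk hB1 (by
      refine le_trans ?_ hkn
      refine mul_le_mul_of_nonneg_left (hBle.trans ?_) (by positivity)
      gcongr
      linarith)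
    obtain ⟨X, i1, i2, P, hX, h⟩ := exists_space_of_sign_pattern (k := k) (blockPattern f) (n := n)
      hz (by simpa using hcard)
    refine ⟨X, i1, i2, P, hX, fun Ω w Δ hΩ => ?_⟩
    obtain ⟨v, hv, hvΩ⟩ := h ε Ω w Δ hΩ
    have h5 := hv.card_le_two_mul hT hk hL hB1 hε hsqrt le_rfl hf
    have hvΩ' : ((univ.filter fun x => v x ≠ 0).card : ℝ) ≤ Ω.card := by exact_mod_cast hvΩ
    have h6 : (k * (L * B) : ℝ) ≤ 2 * Ω.card := h5.trans (by gcongr)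
    calc α / 100000 * ((k : ℝ) * (1 / ε) ^ 2 * Real.log n)
        ≤ α / 80000 * ((k : ℝ) * (1 / ε) ^ 2 * Real.log n) := by gcongr; norm_num
      _ = k * ((α / 8 * Real.log n) * ((1 / ε) ^ 2 / 5000)) / 2 := by ring
      _ ≤ k * (L * B) / 2 := by gcongr
      _ ≤ Ω.card := by linarith

end Clustering

theorem mainTheorem3 :
    ∀ α : ℝ, 0 < α → ∃ c : ℝ, 0 < c ∧
      ∀ (ε : ℝ) (k z n : ℕ), 0 < ε → ε < 1 / 2 → 1 ≤ k → 1 ≤ z →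
        (1 / ε) ^ 5 ≤ (n : ℝ) →
        (k : ℝ) * (1 / ε) ^ 2 ≤ (n : ℝ) ^ (1 - α) →
        ∃ (X : Type) (_ : Fintype X) (_ : MetricSpace X) (P : Finset X),
          Fintype.card X = n ∧
          ∀ (Ω : Finset X) (w : X → ℝ) (Δ : ℝ),
            Clustering.IsCoreset ε k z P Ω w Δ →
            c * ((k : ℝ) * (1 / ε) ^ 2 * Real.log (n : ℝ)) ≤ (Ω.card : ℝ) := by
  intro α₀ hα₀
  -- The hypothesis becomes weaker when the exponent `α` is decreased.
  obtain ⟨α, hα, hα1, hαα⟩ : ∃ α : ℝ, 0 < α ∧ α ≤ 1 / 2 ∧ α ≤ α₀ :=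
    ⟨min α₀ (1 / 2), lt_min hα₀ (by norm_num), min_le_right _ _, min_le_left _ _⟩
  obtain ⟨n₀, hn₀⟩ := Clustering.eventually_large hα
  have hc : 0 < min (α / 100000) (1 / (n₀ ^ 2 + 1 : ℝ)) := by positivity
  refine ⟨_, hc, fun ε k z n hε hε2 hk hz hn hkn => ?_⟩
  have hnpos : (0 : ℝ) < n := lt_of_lt_of_le (by positivity) hn
  have hn1 : (1 : ℝ) ≤ n := by exact_mod_cast (by exact_mod_cast hnpos : 0 < n)
  replace hkn := hkn.trans
    (Real.rpow_le_rpow_of_exponent_le hn1 (by linarith : 1 - α₀ ≤ 1 - α))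
  have hlog0 : 0 ≤ Real.log n := Real.log_natCast_nonneg n
  rcases le_or_gt n₀ n with hnn | hnn
  · obtain ⟨h9, hlog, hpow⟩ := hn₀ n hnn
    obtain ⟨X, i1, i2, P, hX, h⟩ :=
      Clustering.exists_space_of_large hα hα1 h9 hlog hpow hε hε2 hk hz hkn
    refine ⟨X, i1, i2, P, hX, fun Ω w Δ hΩ => le_trans ?_ (h Ω w Δ hΩ)⟩
    gcongr
    exact min_le_left _ _
  · -- For bounded `n` the bound is at most `1`, and any instance without empty coreset will do.
    have hkn' : (k : ℝ) * (1 / ε) ^ 2 ≤ n := hkn.trans <| by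
      simpa using Real.rpow_le_rpow_of_exponent_le hn1 (by linarith : 1 - α ≤ 1)
    have hk0 : (0 : ℝ) < k := by exact_mod_cast hk
    have hlt : k < n := by
      have h1 : 1 < 1 / ε := by rw [lt_div_iff₀ hε]; linarith
      have h2 : 1 < (1 / ε) ^ 2 := one_lt_pow₀ h1 two_ne_zero
      have : (k : ℝ) < n := by nlinarith
      exact_mod_cast this
    refine ⟨Fin n, inferInstance, MetricSpace.induced (fun i : Fin n => ((i : ℕ) : ℝ))
      (fun i j hij => Fin.ext (Nat.cast_injective hij)) inferInstance, {⟨0, by omega⟩}, by simp,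
      fun Ω w Δ hΩ => ?_⟩
    have h1 : (1 : ℝ) ≤ Ω.card := by
      let _ : MetricSpace (Fin n) := MetricSpace.induced (fun i : Fin n => ((i : ℕ) : ℝ))
        (fun i j hij => Fin.ext (Nat.cast_injective hij)) inferInstance
      exact_mod_cast Finset.card_pos.2
        (hΩ.nonempty_of_singleton (by linarith) hk hz (by simpa using hlt))
    refine le_trans ?_ h1
    have hnn' : (n : ℝ) ≤ n₀ := by exact_mod_cast hnn.le
    have hlogn : Real.log n ≤ n := (Real.log_le_sub_one_of_pos hnpos).trans (by linarith)
    calc _ ≤ 1 / (n₀ ^ 2 + 1 : ℝ) * (n₀ * n₀) := by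
          gcongr
          · exact min_le_right _ _
          · exact hkn'.trans hnn'
          · exact hlogn.trans hnn'
      _ ≤ 1 := by
          rw [one_div, inv_mul_le_iff₀ (by positivity)]
          nlinarith
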